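/- All structures are finite. A 3-uniform hypergraph $H$ has a vertex set $V(H)$ and an edge set $E(H)\subseteq\binom{V(H)}{3}$; more generally the edges of a hypergraph are subsets of its vertex set with at least two elements. For $W\subseteq V(H)$, $H[W]$ is the hypergraph on $W$ with edge set $\{e\in E(H):e\subseteq W\}$. A set $M\subseteq V(H)$ is a module of $H$ if for each $e\in E(H)$ with $e\cap M\neq\emptyset$ and $e\setminus M\neq\emptyset$ there is $m\in M$ such that $e\cap M=\{m\}$ and $(e\setminus\{m\})\cup\{n\}\in E(H)$ for every $n\in M$. A set $M\subseteq V(T)$ is a module of a tournament $T$ if for all $x,y\in M$ and $v\in V(T)$, whenever $xv$ and $vy$ are arcs of $T$, we have $v\in M$. In both cases a module $M$ is strong if every module $N$ with $M\cap N\neq\emptyset$ satisfies $M\subseteq N$ or $N\subseteq M$, and, if there are at least two vertices, $\Pi(H)$ (respectively $\Pi(T)$) denotes the set of the inclusion-maximal strong modules different from the whole vertex set; it is a partition of the vertex set into modules. The quotient $H/\Pi(H)$ is the hypergraph on $\Pi(H)$ whose edges are the sets $\mathcal E\subseteq \Pi(H)$ with $|\mathcal E|\ge 2$ such that $\mathcal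 E=\{X\in\Pi(H):X\cap e\neq\emptyset\}$ for some $e\in E(H)$. The quotient $T/\Pi(T)$ is the tournament on $\Pi(T)$ in which, for $X\neq Y$, $XY$ is an arc if $xy$ is an arc of $T$ for $x\in X$, $y\in Y$. A tournament $T$ is a realization of a hypergraph $H$ if $V(T)=V(H)$ and $E(H)$ is exactly the set of those subsets of $V(T)$ that induce a 3-cycle in $T$; $\mathscr R(H)$ denotes the set of realizations of $H$. Proposition. Let $H$ be a finite 3-uniform hypergraph (not assumed realizable), and let $\mathscr D_{\ge2}(H)$ be the set of strong modules of $H$ with at least two elements. Let $\mathscr Q(H)$ be the set of functions $f$ on $\mathscr D_{\ge2}(H)$ such that $f(X)\in\mathscr R(H[X]/\Pi(H[X]))$ for every $X\in\mathscr D_{\ge2}(H)$. Then for every $T\in\mathscr R(H)$ the function $\delta_H(T):X\mapsto T[X]/\Pi(T[X])$ $(X\in\mathscr D_{\ge2}(H))$ belongs to $\mathscr Q(H)$, and the map $\delta_H:\mathscr R(H)\to\mathscr Q(H)$ is a bijection. -/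

import Mathlib

/-- `P` is a partition of the set `V`. -/
def IsPartitionOf {α : Type*} (V : Set α) (P : Set (Set α)) : Prop :=
  (∀ X ∈ P, X.Nonempty ∧ X ⊆ V) ∧ ∀ v ∈ V, ∃! X, X ∈ P ∧ v ∈ X

/-- `M` is a strong member of a family `F` of sets (below, `F` is the family of all modules of a
hypergraph or of a tournament): it is comparable to every member of `F` that it meets. -/
def IsStrongMember {α : Type*} (F : Set (Set α)) (M : Set α) : Prop :=
  M ∈ F ∧ ∀ N ∈ F, (M ∩ N).Nonempty → M ⊆ N ∨ N ⊆ M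

/-- The inclusion-maximal elements among the strong members of `F` that are proper subsets
of `V`. -/
def maxProperStrong {α : Type*} (V : Set α) (F : Set (Set α)) : Set (Set α) :=
  {M | Maximal (fun X => IsStrongMember F X ∧ X ⊂ V) M}

theorem mem_maxProperStrong {α : Type*} {V : Set α} {F : Set (Set α)} {M : Set α} :
    M ∈ maxProperStrong V F ↔ Maximal (fun X => IsStrongMember F X ∧ X ⊂ V) M :=
  Iff.rfl

theorem isPartitionOf_maxProperStrong {α : Type*} {V : Set α} {F : Set (Set α)}
    (hsing : ∀ v ∈ V, ({v} : Set α) ∈ F)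
    (hcard : 2 ≤ V.ncard) : IsPartitionOf V (maxProperStrong V F) := by
  have hfin : V.Finite := Set.finite_of_ncard_ne_zero (by omega)
  have hnt : V.Nontrivial := (Set.one_lt_ncard_iff_nontrivial_and_finite.1 hcard).1
  have hstr : ∀ v ∈ V, IsStrongMember F {v} ∧ ({v} : Set α) ⊂ V := by
    intro v hv
    refine ⟨⟨hsing v hv, ?_⟩, ?_⟩
    · rintro N _ ⟨x, hx, hxN⟩
      left
      rw [Set.mem_singleton_iff] at hx
      subst hx
      simpa using hxN
    · refine ⟨by simpa using hv, fun h => ?_⟩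
      obtain ⟨w, hw, hne⟩ := hnt.exists_ne v
      exact hne (h hw)
  have hex : ∀ v ∈ V, ∃ X, Maximal (fun X => IsStrongMember F X ∧ X ⊂ V) X ∧ v ∈ X := by
    intro v hv
    have hf : {X : Set α | IsStrongMember F X ∧ X ⊂ V}.Finite :=
      hfin.finite_subsets.subset fun X hX => hX.2.subset
    obtain ⟨X, hle, hX⟩ := hf.exists_le_maximal (hstr v hv)
    exact ⟨X, hX, hle rfl⟩
  refine ⟨fun X hX => ?_, fun v hv => ?_⟩
  · rw [mem_maxProperStrong] at hX
    refine ⟨?_, hX.prop.2.subset⟩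
    obtain ⟨v, hv⟩ := hnt.nonempty
    by_contra h
    rw [Set.not_nonempty_iff_eq_empty] at h
    subst h
    exact hX.le_of_ge (hstr v hv) (Set.empty_subset _) rfl
  · obtain ⟨X, hX, hvX⟩ := hex v hv
    refine ⟨X, ⟨hX, hvX⟩, ?_⟩
    rintro Y ⟨hY, hvY⟩
    rw [mem_maxProperStrong] at hY
    rcases hX.prop.1.2 Y hY.prop.1.1 ⟨v, hvX, hvY⟩ with h | h
    · exact (hX.eq_of_le hY.prop h).symm
    · exact hY.eq_of_le hX.prop h

namespace Hypergraph

def IsUniform {α : Type*} (H : Hypergraph α) (k : ℕ) : Prop :=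
  ∀ e ∈ H.edgeSet, e.ncard = k

/-- The induced subhypergraph `H[W]`. -/
def induce {α : Type*} (H : Hypergraph α) (W : Set α) (_hW : W ⊆ H.vertexSet) : Hypergraph α where
  vertexSet := W
  edgeSet := {e | e ∈ H.edgeSet ∧ e ⊆ W}
  subset_vertexSet_of_mem_edgeSet' := fun _ he => he.2

def IsModule {α : Type*} (H : Hypergraph α) (M : Set α) : Prop :=
  M ⊆ H.vertexSet ∧
    ∀ e ∈ H.edgeSet, (e ∩ M).Nonempty → (e \ M).Nonempty →
      ∃ m ∈ M, e ∩ M = {m} ∧ ∀ n ∈ M, (e \ {m}) ∪ {n} ∈ H.edgeSet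

def modules {α : Type*} (H : Hypergraph α) : Set (Set α) := {M | H.IsModule M}

def IsStrongModule {α : Type*} (H : Hypergraph α) (M : Set α) : Prop :=
  IsStrongMember H.modules M

/-- `Π(H)`: the maximal proper strong modules of `H`. -/
def Pi {α : Type*} (H : Hypergraph α) : Set (Set α) := maxProperStrong H.vertexSet H.modules

def IsModularPartition {α : Type*} (H : Hypergraph α) (P : Set (Set α)) : Prop :=
  IsPartitionOf H.vertexSet P ∧ ∀ X ∈ P, H.IsModule X

/-- The quotient `H/P`, a hypergraph with vertex set `P`. -/
def quotient {α : Type*} (H : Hypergraph α) (P : Set (Set α)) (_hP : H.IsModularPartition P) :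
    Hypergraph (Set α) where
  vertexSet := P
  edgeSet := {E | E ⊆ P ∧ 2 ≤ E.ncard ∧ ∃ e ∈ H.edgeSet, E = {X | X ∈ P ∧ (X ∩ e).Nonempty}}
  subset_vertexSet_of_mem_edgeSet' := fun _ hE => hE.1

theorem isModule_singleton {α : Type*} (H : Hypergraph α) {v : α} (hv : v ∈ H.vertexSet) :
    H.IsModule {v} := by
  refine ⟨by simpa using hv, fun e he h1 _ => ?_⟩
  have hve : v ∈ e := by
    obtain ⟨x, hx, hxv⟩ := h1
    rw [Set.mem_singleton_iff] at hxv
    exact hxv ▸ hx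
  refine ⟨v, rfl, by simpa using hve, fun n hn => ?_⟩
  rw [Set.mem_singleton_iff] at hn
  subst hn
  rw [Set.sdiff_union_of_subset (by simpa using hve)]
  exact he

theorem isModularPartition_Pi {α : Type*} (H : Hypergraph α) (h : 2 ≤ H.vertexSet.ncard) :
    H.IsModularPartition H.Pi :=
  ⟨isPartitionOf_maxProperStrong (fun _ hv => H.isModule_singleton hv) h,
    fun _ hX => (mem_maxProperStrong.1 hX).prop.1.1⟩

/-- `H/Π(H)`, for a hypergraph `H` with at least two vertices. -/
def quotientPi {α : Type*} (H : Hypergraph α) (h : 2 ≤ H.vertexSet.ncard) : Hypergraph (Set α) :=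
  H.quotient H.Pi (H.isModularPartition_Pi h)

/-- The strong modules of `H` with at least two elements. -/
def strongModulesGeTwo {α : Type*} (H : Hypergraph α) : Set (Set α) :=
  {X | H.IsStrongModule X ∧ 2 ≤ X.ncard}

end Hypergraph

/-- A finite tournament whose vertices are taken from the type `α`. -/
@[ext]
structure Tournament (α : Type*) where
  vertexSet : Set α
  arc : α → α → Prop
  finite_vertexSet : vertexSet.Finite
  arc_mem : ∀ x y, arc x y → x ∈ vertexSet ∧ y ∈ vertexSet
  irrefl : ∀ x, ¬ arc x x
  arc_iff_not_arc : ∀ x ∈ vertexSet, ∀ y ∈ vertexSet, x ≠ y → (arc x y ↔ ¬ arc y x)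

namespace Tournament

/-- The induced subtournament `T[W]`. -/
def induce {α : Type*} (T : Tournament α) (W : Set α) (hW : W ⊆ T.vertexSet) : Tournament α where
  vertexSet := W
  arc := fun x y => x ∈ W ∧ y ∈ W ∧ T.arc x y
  finite_vertexSet := T.finite_vertexSet.subset hW
  arc_mem := fun _ _ h => ⟨h.1, h.2.1⟩
  irrefl := fun x h => T.irrefl x h.2.2
  arc_iff_not_arc := fun x hx y hy hne => by
    simp [hx, hy, T.arc_iff_not_arc x (hW hx) y (hW hy) hne]

/-- The `3`-cycle, with vertices `0, 1, 2` and arcs `01, 12, 20`. -/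
def cycle3 : Tournament (Fin 3) where
  vertexSet := Set.univ
  arc := fun i j => j = i + 1
  finite_vertexSet := Set.finite_univ
  arc_mem := fun _ _ _ => ⟨trivial, trivial⟩
  irrefl := by decide
  arc_iff_not_arc := fun x _ y _ => by revert x y; decide

def IsIso {α β : Type*} (T : Tournament α) (T' : Tournament β) : Prop :=
  ∃ f : T.vertexSet ≃ T'.vertexSet, ∀ x y : T.vertexSet, T.arc x y ↔ T'.arc (f x) (f y)

/-- The `C₃`-structure of `T`: its edges are the sets of vertices that induce a `3`-cycle. -/
def c3Structure {α : Type*} (T : Tournament α) : Hypergraph α where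
  vertexSet := T.vertexSet
  edgeSet := {X | ∃ hX : X ⊆ T.vertexSet, (T.induce X hX).IsIso cycle3}
  subset_vertexSet_of_mem_edgeSet' := fun _ h => h.1

def Realizes {α : Type*} (T : Tournament α) (H : Hypergraph α) : Prop :=
  H = T.c3Structure

def IsModule {α : Type*} (T : Tournament α) (M : Set α) : Prop :=
  M ⊆ T.vertexSet ∧ ∀ x ∈ M, ∀ y ∈ M, ∀ v ∈ T.vertexSet, T.arc x v → T.arc v y → v ∈ M

def modules {α : Type*} (T : Tournament α) : Set (Set α) := {M | T.IsModule M}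

/-- `Π(T)`: the maximal proper strong modules of `T`. -/
def Pi {α : Type*} (T : Tournament α) : Set (Set α) := maxProperStrong T.vertexSet T.modules

def IsModularPartition {α : Type*} (T : Tournament α) (P : Set (Set α)) : Prop :=
  IsPartitionOf T.vertexSet P ∧ ∀ X ∈ P, T.IsModule X

/-- The quotient `T/P`, a tournament with vertex set `P`. -/
def quotient {α : Type*} (T : Tournament α) (P : Set (Set α)) (hP : T.IsModularPartition P) :
    Tournament (Set α) where
  vertexSet := P
  arc := fun X Y => X ∈ P ∧ Y ∈ P ∧ X ≠ Y ∧ ∃ x ∈ X, ∃ y ∈ Y, T.arc x y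
  finite_vertexSet := T.finite_vertexSet.finite_subsets.subset fun X hX => (hP.1.1 X hX).2
  arc_mem := fun _ _ h => ⟨h.1, h.2.1⟩
  irrefl := fun _ h => h.2.2.1 rfl
  arc_iff_not_arc := by
    intro X hX Y hY hne
    obtain ⟨⟨x₀, hx₀⟩, hXV⟩ := hP.1.1 X hX
    obtain ⟨⟨y₀, hy₀⟩, hYV⟩ := hP.1.1 Y hY
    have hdisj : ∀ z, z ∈ X → z ∈ Y → False := fun z hzX hzY =>
      hne ((hP.1.2 z (hXV hzX)).unique ⟨hX, hzX⟩ ⟨hY, hzY⟩)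
    have htot : ∀ x ∈ X, ∀ y ∈ Y, (T.arc x y ↔ ¬ T.arc y x) := fun x hx y hy =>
      T.arc_iff_not_arc x (hXV hx) y (hYV hy) fun h => hdisj x hx (h ▸ hy)
    constructor
    · rintro ⟨-, -, -, x, hx, y, hy, hxy⟩ ⟨-, -, -, y', hy', x', hx', hyx⟩
      have h1 : T.arc x' y := by
        rw [htot x' hx' y hy]
        exact fun h => hdisj y ((hP.2 X hX).2 x hx x' hx' y (hYV hy) hxy h) hy
      exact hdisj x' hx' ((hP.2 Y hY).2 y' hy' y hy x' (hXV hx') hyx h1)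
    · intro h
      refine ⟨hX, hY, hne, x₀, hx₀, y₀, hy₀, ?_⟩
      rw [htot x₀ hx₀ y₀ hy₀]
      exact fun h' => h ⟨hY, hX, hne.symm, y₀, hy₀, x₀, hx₀, h'⟩

theorem isModule_singleton {α : Type*} (T : Tournament α) {v : α} (hv : v ∈ T.vertexSet) :
    T.IsModule {v} := by
  refine ⟨by simpa using hv, ?_⟩
  intro x hx y hy w hw hxw hwy
  rw [Set.mem_singleton_iff] at hx hy
  subst hx hy
  by_cases h : y = w
  · exact h.symm
  · exact absurd hwy ((T.arc_iff_not_arc y hv w hw h).1 hxw)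

theorem isModularPartition_Pi {α : Type*} (T : Tournament α) (h : 2 ≤ T.vertexSet.ncard) :
    T.IsModularPartition T.Pi :=
  ⟨isPartitionOf_maxProperStrong (fun _ hv => T.isModule_singleton hv) h,
    fun _ hX => (mem_maxProperStrong.1 hX).prop.1.1⟩

/-- `T/Π(T)`, for a tournament `T` with at least two vertices. -/
def quotientPi {α : Type*} (T : Tournament α) (h : 2 ≤ T.vertexSet.ncard) : Tournament (Set α) :=
  T.quotient T.Pi (T.isModularPartition_Pi h)

end Tournament

namespace Hypergraph

/-- The set of the realizations of `H`. -/
def realizations {α : Type*} (H : Hypergraph α) : Set (Tournament α) := {T | T.Realizes H}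

theorem subset_vertexSet_of_strong {α : Type*} (H : Hypergraph α) (X : H.strongModulesGeTwo) :
    (X : Set α) ⊆ H.vertexSet :=
  X.2.1.1.1

/-- `H[X]/Π(H[X])`, for a strong module `X` of `H` with at least two elements. -/
def factor {α : Type*} (H : Hypergraph α) (X : H.strongModulesGeTwo) : Hypergraph (Set α) :=
  (H.induce X (H.subset_vertexSet_of_strong X)).quotientPi X.2.2

/-- The functions that choose, for each strong module `X` of `H` with at least two elements, a
realization of `H[X]/Π(H[X])`. -/
def choices {α : Type*} (H : Hypergraph α) : Set (H.strongModulesGeTwo → Tournament (Set α)) :=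
  {f | ∀ X, f X ∈ (H.factor X).realizations}

theorem subset_vertexSet_of_realization {α : Type*} (H : Hypergraph α) (T : H.realizations)
    (X : H.strongModulesGeTwo) : (X : Set α) ⊆ T.1.vertexSet := by
  have h : H.vertexSet = T.1.vertexSet := congrArg Hypergraph.vertexSet T.2
  exact h ▸ H.subset_vertexSet_of_strong X

/-- The function `X ↦ T[X]/Π(T[X])` associated with a realization `T` of `H`. -/
def delta {α : Type*} (H : Hypergraph α) (T : H.realizations) :
    H.strongModulesGeTwo → Tournament (Set α) :=
  fun X => (T.1.induce X (H.subset_vertexSet_of_realization T X)).quotientPi X.2.2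

end Hypergraph

theorem Set.insert_rotate {α : Type*} (x y z : α) : ({x, y, z} : Set α) = {y, z, x} := by
  rw [Set.insert_comm, Set.pair_comm x z]

namespace Tournament

variable {α : Type*} {T : Tournament α}

theorem arc_asymm {x y : α} (h : T.arc x y) : ¬ T.arc y x := by
  have hm := T.arc_mem x y h
  have hne : x ≠ y := fun e => T.irrefl x (by rwa [← e] at h)
  exact (T.arc_iff_not_arc x hm.1 y hm.2 hne).1 h

theorem arc_or_arc {x y : α} (hx : x ∈ T.vertexSet) (hy : y ∈ T.vertexSet) (hne : x ≠ y) :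
    T.arc x y ∨ T.arc y x := by
  by_cases h : T.arc y x
  · exact Or.inr h
  · exact Or.inl ((T.arc_iff_not_arc x hx y hy hne).2 h)

theorem ne_of_arc {x y : α} (h : T.arc x y) : x ≠ y := by
  rintro rfl
  exact T.irrefl x h

/-- The arcs `xy`, `yz`, `zx` form a `3`-cycle. -/
def IsCycle (T : Tournament α) (x y z : α) : Prop :=
  T.arc x y ∧ T.arc y z ∧ T.arc z x

theorem mem_edgeSet_c3Structure {e : Set α} :
    e ∈ T.c3Structure.edgeSet ↔ ∃ x y z, T.IsCycle x y z ∧ e = {x, y, z} := by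
  constructor
  · rintro ⟨hX, f, hf⟩
    have key : ∀ i j : Fin 3, j = i + 1 →
        T.arc (f.symm ⟨i, trivial⟩ : _) (f.symm ⟨j, trivial⟩ : _) := by
      intro i j hij
      have := (hf (f.symm ⟨i, trivial⟩) (f.symm ⟨j, trivial⟩)).2 (by
        rw [Equiv.apply_symm_apply, Equiv.apply_symm_apply]; exact hij)
      exact this.2.2
    refine ⟨f.symm ⟨0, trivial⟩, f.symm ⟨1, trivial⟩, f.symm ⟨2, trivial⟩,
      ⟨key 0 1 rfl, key 1 2 rfl, key 2 0 rfl⟩, ?_⟩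
    ext v
    constructor
    · intro hv
      obtain ⟨⟨i, hi⟩, h⟩ := f.symm.surjective ⟨v, hv⟩
      have hv' : v = f.symm ⟨i, hi⟩ := by rw [h]
      rw [hv']
      fin_cases i
      · exact Or.inl rfl
      · exact Or.inr (Or.inl rfl)
      · exact Or.inr (Or.inr rfl)
    · rintro (rfl | rfl | rfl) <;> exact Subtype.coe_prop _
  · rintro ⟨x, y, z, ⟨hxy, hyz, hzx⟩, rfl⟩
    have hX : ({x, y, z} : Set α) ⊆ T.vertexSet := by
      rintro v (rfl | rfl | rfl)
      · exact (T.arc_mem _ _ hxy).1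
      · exact (T.arc_mem _ _ hxy).2
      · exact (T.arc_mem _ _ hyz).2
    refine ⟨hX, ?_⟩
    let g : cycle3.vertexSet → (T.induce {x, y, z} hX).vertexSet := fun i =>
      ⟨![x, y, z] i.1, by
        obtain ⟨i, hi⟩ := i
        fin_cases i
        · exact Or.inl rfl
        · exact Or.inr (Or.inl rfl)
        · exact Or.inr (Or.inr rfl)⟩
    have h1 := ne_of_arc hxy
    have h2 := ne_of_arc hyz
    have h3 := ne_of_arc hzx
    have hg : Function.Bijective g := by
      constructor
      · rintro ⟨i, hi⟩ ⟨j, hj⟩ h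
        have h : (![x, y, z] i : α) = ![x, y, z] j := congrArg Subtype.val h
        apply Subtype.ext
        fin_cases i <;> fin_cases j <;> simp_all
      · rintro ⟨v, (rfl | rfl | rfl)⟩
        · exact ⟨⟨0, trivial⟩, rfl⟩
        · exact ⟨⟨1, trivial⟩, rfl⟩
        · exact ⟨⟨2, trivial⟩, rfl⟩
    refine ⟨(Equiv.ofBijective g hg).symm, ?_⟩
    intro u v
    obtain ⟨i, rfl⟩ := (Equiv.ofBijective g hg).surjective u
    obtain ⟨j, rfl⟩ := (Equiv.ofBijective g hg).surjective v
    rw [Equiv.symm_apply_apply, Equiv.symm_apply_apply]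
    have hyx := arc_asymm hxy
    have hzy := arc_asymm hyz
    have hxz := arc_asymm hzx
    have hc : ((T.induce {x, y, z} hX).arc (Equiv.ofBijective g hg i)
        (Equiv.ofBijective g hg j)) ↔ T.arc (![x, y, z] i.1) (![x, y, z] j.1) :=
      ⟨fun h => h.2.2, fun h => ⟨(g i).2, (g j).2, h⟩⟩
    rw [hc]
    obtain ⟨i, hi⟩ := i
    obtain ⟨j, hj⟩ := j
    have := T.irrefl
    fin_cases i <;> fin_cases j <;> simp_all [cycle3]

theorem insert_mem_edgeSet_c3Structure {x y z : α} :
    ({x, y, z} : Set α) ∈ T.c3Structure.edgeSet ↔ T.IsCycle x y z ∨ T.IsCycle x z y := by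
  rw [mem_edgeSet_c3Structure]
  constructor
  · rintro ⟨a, b, c, ⟨h1, h2, h3⟩, h⟩
    have n1 := ne_of_arc h1
    have n2 := ne_of_arc h2
    have n3 := ne_of_arc h3
    have ha : a ∈ ({x, y, z} : Set α) := h ▸ Or.inl rfl
    have hb : b ∈ ({x, y, z} : Set α) := h ▸ Or.inr (Or.inl rfl)
    have hc : c ∈ ({x, y, z} : Set α) := h ▸ Or.inr (Or.inr rfl)
    simp only [Set.mem_insert_iff, Set.mem_singleton_iff] at ha hb hc
    unfold IsCycle
    rcases ha with rfl | rfl | rfl <;> rcases hb with rfl | rfl | rfl <;>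
      rcases hc with rfl | rfl | rfl <;> first | contradiction | tauto
  · rintro (h | h)
    · exact ⟨x, y, z, h, rfl⟩
    · exact ⟨x, z, y, h, by rw [Set.pair_comm]⟩

theorem IsModule.arc_left {M : Set α} (hM : T.IsModule M) {x y v : α} (hx : x ∈ M) (hy : y ∈ M)
    (hv : v ∉ M) (h : T.arc x v) : T.arc y v := by
  have hvV := (T.arc_mem _ _ h).2
  rcases arc_or_arc (hM.1 hy) hvV (fun e => hv (e ▸ hy)) with h' | h'
  · exact h'
  · exact absurd (hM.2 x hx y hy v hvV h h') hv

theorem IsModule.arc_right {M : Set α} (hM : T.IsModule M) {x y v : α} (hx : x ∈ M) (hy : y ∈ M)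
    (hv : v ∉ M) (h : T.arc v x) : T.arc v y := by
  have hvV := (T.arc_mem _ _ h).1
  rcases arc_or_arc (hM.1 hy) hvV (fun e => hv (e ▸ hy)) with h' | h'
  · exact absurd (hM.2 y hy x hx v hvV h' h) hv
  · exact h'

theorem IsModule.c3Structure {M : Set α} (hM : T.IsModule M) : T.c3Structure.IsModule M := by
  refine ⟨hM.1, ?_⟩
  have key : ∀ x y z, T.IsCycle x y z → x ∈ M → (({x, y, z} : Set α) \ M).Nonempty →
      ∃ m ∈ M, ({x, y, z} : Set α) ∩ M = {m} ∧
        ∀ n ∈ M, ({x, y, z} \ {m}) ∪ {n} ∈ T.c3Structure.edgeSet := by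
    rintro x y z ⟨h1, h2, h3⟩ hx hne
    have n1 := ne_of_arc h1
    have n2 := ne_of_arc h2
    have n3 := ne_of_arc h3
    have hy : y ∉ M := by
      intro hy
      have hz := hM.2 y hy x hx z (T.arc_mem _ _ h2).2 h2 h3
      obtain ⟨v, (rfl | rfl | rfl), hv⟩ := hne <;> exact hv (by assumption)
    have hz : z ∉ M := fun hz => hy (hM.2 x hx z hz y (T.arc_mem _ _ h1).2 h1 h2)
    refine ⟨x, hx, ?_, fun n hn => ?_⟩
    · ext v
      simp only [Set.mem_inter_iff, Set.mem_insert_iff, Set.mem_singleton_iff]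
      constructor
      · rintro ⟨(rfl | rfl | rfl), hv⟩ <;> first | rfl | contradiction
      · rintro rfl
        exact ⟨Or.inl rfl, hx⟩
    · have he : (({x, y, z} : Set α) \ {x}) ∪ {n} = {n, y, z} := by
        ext v
        simp only [Set.mem_union, Set.mem_sdiff, Set.mem_insert_iff, Set.mem_singleton_iff]
        grind
      rw [he, insert_mem_edgeSet_c3Structure]
      exact Or.inl ⟨hM.arc_left hx hn hy h1, h2, hM.arc_right hx hn hz h3⟩
  intro e he hne hne'
  obtain ⟨x, y, z, ⟨h1, h2, h3⟩, rfl⟩ := mem_edgeSet_c3Structure.1 he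
  have r1 := Set.insert_rotate x y z
  have r2 := (Set.insert_rotate z x y).symm
  obtain ⟨v, (rfl | rfl | rfl), hv⟩ := hne
  · exact key _ _ _ ⟨h1, h2, h3⟩ hv hne'
  · rw [r1] at hne' ⊢
    exact key _ _ _ ⟨h2, h3, h1⟩ hv hne'
  · rw [r2] at hne' ⊢
    exact key _ _ _ ⟨h3, h1, h2⟩ hv hne'

end Tournament

namespace Tournament

variable {α : Type*} {T : Tournament α}

/-- The vertices of `N` that dominate `v`. -/
def inside (T : Tournament α) (N : Set α) (v : α) : Set α := {x | x ∈ N ∧ T.arc x v}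

/-- The vertices outside `N` that dominate some vertex of `N` and are dominated by another. -/
def splitters (T : Tournament α) (N : Set α) : Set α :=
  {v | v ∈ T.vertexSet ∧ v ∉ N ∧ (∃ x ∈ N, T.arc x v) ∧ ∃ y ∈ N, T.arc v y}

theorem isModule_of_splitters_eq_empty {N : Set α} (hN : N ⊆ T.vertexSet)
    (h : T.splitters N = ∅) : T.IsModule N := by
  refine ⟨hN, fun x hx y hy v hv hxv hvy => ?_⟩
  by_contra hvN
  exact (h ▸ (⟨hv, hvN, ⟨x, hx, hxv⟩, ⟨y, hy, hvy⟩⟩ : v ∈ T.splitters N) : v ∈ (∅ : Set α))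

/-- A `3`-cycle leaving a module of the `C₃`-structure meets it in at most one vertex. -/
theorem not_mem_of_isCycle {N : Set α} (hN : T.c3Structure.IsModule N) {x y v : α}
    (hc : T.IsCycle x y v) (hx : x ∈ N) (hv : v ∉ N) : y ∉ N := by
  intro hy
  obtain ⟨m, -, hm, -⟩ := hN.2 {x, y, v} (mem_edgeSet_c3Structure.2 ⟨x, y, v, hc, rfl⟩)
    ⟨x, Or.inl rfl, hx⟩ ⟨v, Or.inr (Or.inr rfl), hv⟩
  have h1 : x ∈ ({m} : Set α) := hm ▸ ⟨Or.inl rfl, hx⟩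
  have h2 : y ∈ ({m} : Set α) := hm ▸ ⟨Or.inr (Or.inl rfl), hy⟩
  exact ne_of_arc hc.1 (h1.trans h2.symm)

/-- Two vertices outside a module of the `C₃`-structure form a `3`-cycle with one vertex of the
module only if they do with all. -/
theorem isCycle_of_isCycle {N : Set α} (hN : T.c3Structure.IsModule N) {m n v w : α}
    (hc : T.IsCycle m v w) (hm : m ∈ N) (hv : v ∉ N) (hw : w ∉ N) (hn : n ∈ N) :
    T.IsCycle n v w := by
  obtain ⟨m', hm'N, hm', H⟩ := hN.2 {m, v, w} (mem_edgeSet_c3Structure.2 ⟨m, v, w, hc, rfl⟩)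
    ⟨m, Or.inl rfl, hm⟩ ⟨v, Or.inr (Or.inl rfl), hv⟩
  have h1 : m = m' := by
    have : m ∈ ({m'} : Set α) := hm' ▸ ⟨Or.inl rfl, hm⟩
    exact this
  subst h1
  have h2 := H n hn
  have he : (({m, v, w} : Set α) \ {m}) ∪ {n} = {n, v, w} := by
    ext u
    simp only [Set.mem_union, Set.mem_sdiff, Set.mem_insert_iff, Set.mem_singleton_iff]
    grind
  rw [he, insert_mem_edgeSet_c3Structure] at h2
  rcases h2 with h2 | h2
  · exact h2
  · exact absurd h2.2.1 (arc_asymm hc.2.1)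

theorem arc_of_mem_splitters {N : Set α} (hN : T.c3Structure.IsModule N) {v a b : α}
    (hv : v ∈ T.splitters N) (ha : a ∈ N) (hb : b ∈ N) (hav : T.arc a v) (hvb : T.arc v b) :
    T.arc a b := by
  have hne : a ≠ b := by
    rintro rfl
    exact arc_asymm hav hvb
  rcases arc_or_arc (hN.1 ha) (hN.1 hb) hne with h | h
  · exact h
  · exact absurd ha (not_mem_of_isCycle hN ⟨h, hav, hvb⟩ hb hv.2.1)

theorem inside_subset_of_arc {N : Set α} (hN : T.c3Structure.IsModule N) {v w : α}
    (hvw : T.arc v w) (hv : v ∉ N) (hw : w ∉ N) (hs : v ∈ T.splitters N ∨ w ∈ T.splitters N) :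
    T.inside N v ⊆ T.inside N w := by
  rintro a ⟨ha, hav⟩
  refine ⟨ha, ?_⟩
  have hwV := (T.arc_mem _ _ hvw).2
  rcases arc_or_arc (hN.1 ha) hwV (fun e => hw (e ▸ ha)) with h | h
  · exact h
  · exfalso
    have hall := fun n hn => isCycle_of_isCycle hN ⟨hav, hvw, h⟩ ha hv hw (n := n) hn
    rcases hs with hs | hs
    · obtain ⟨-, -, -, y, hy, hvy⟩ := hs
      exact arc_asymm hvy (hall y hy).1
    · obtain ⟨-, -, ⟨x, hx, hxw⟩, -⟩ := hs
      exact arc_asymm hxw (hall x hx).2.2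

theorem isModule_union_splitters {N : Set α} (hN : T.c3Structure.IsModule N) :
    T.IsModule (N ∪ T.splitters N) := by
  have hsub : N ∪ T.splitters N ⊆ T.vertexSet := Set.union_subset hN.1 fun v hv => hv.1
  have main : ∀ w ∈ T.vertexSet, w ∉ N ∪ T.splitters N →
      (∀ n ∈ N, T.arc n w → ∀ u ∈ N ∪ T.splitters N, T.arc u w) ∧
      (∀ n ∈ N, T.arc w n → ∀ u ∈ N ∪ T.splitters N, T.arc w u) := by
    intro w hwV hw
    have hwN : w ∉ N := fun h => hw (Or.inl h)
    have hwS : w ∉ T.splitters N := fun h => hw (Or.inr h)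
    refine ⟨fun n hn hnw u hu => ?_, fun n hn hnw u hu => ?_⟩
    · have hall : ∀ a ∈ N, T.arc a w := fun a ha => by
        rcases arc_or_arc (hN.1 ha) hwV (fun e => hwN (e ▸ ha)) with h | h
        · exact h
        · exact absurd ⟨hwV, hwN, ⟨n, hn, hnw⟩, ⟨a, ha, h⟩⟩ hwS
      rcases hu with hu | hu
      · exact hall u hu
      · rcases arc_or_arc hu.1 hwV (fun e => hwS (e ▸ hu)) with h | h
        · exact h
        · exfalso
          obtain ⟨y, hy, huy⟩ := hu.2.2.2
          exact arc_asymm huy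
            (inside_subset_of_arc hN h hwN hu.2.1 (Or.inr hu) ⟨hy, hall y hy⟩).2
    · have hall : ∀ a ∈ N, T.arc w a := fun a ha => by
        rcases arc_or_arc (hN.1 ha) hwV (fun e => hwN (e ▸ ha)) with h | h
        · exact absurd ⟨hwV, hwN, ⟨a, ha, h⟩, ⟨n, hn, hnw⟩⟩ hwS
        · exact h
      rcases hu with hu | hu
      · exact hall u hu
      · rcases arc_or_arc hu.1 hwV (fun e => hwS (e ▸ hu)) with h | h
        · exfalso
          obtain ⟨x, hx, hxu⟩ := hu.2.2.1
          exact arc_asymm (hall x hx)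
            (inside_subset_of_arc hN h hu.2.1 hwN (Or.inl hu) ⟨hx, hxu⟩).2
        · exact h
  refine ⟨hsub, fun x hx y hy w hw hxw hwy => ?_⟩
  by_contra hwQ
  obtain ⟨n, hn⟩ : N.Nonempty := by
    rcases hx with hx | hx
    · exact ⟨x, hx⟩
    · obtain ⟨a, ha, -⟩ := hx.2.2.1
      exact ⟨a, ha⟩
  rcases arc_or_arc (hN.1 hn) hw (fun e => hwQ (Or.inl (e ▸ hn))) with h | h
  · exact arc_asymm hwy ((main w hw hwQ).1 n hn h y hy)
  · exact arc_asymm hxw ((main w hw hwQ).2 n hn h x hx)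

/-- If a module splits into two parts, all the arcs between which go from the first to the second,
then both parts are modules. -/
theorem IsModule.of_cut {L R : Set α} (hQ : T.IsModule (L ∪ R))
    (h : ∀ a ∈ L, ∀ b ∈ R, T.arc a b) : T.IsModule L ∧ T.IsModule R := by
  refine ⟨⟨fun x hx => hQ.1 (Or.inl hx), fun x hx y hy v hv hxv hvy => ?_⟩,
    ⟨fun x hx => hQ.1 (Or.inr hx), fun x hx y hy v hv hxv hvy => ?_⟩⟩
  · rcases hQ.2 x (Or.inl hx) y (Or.inl hy) v hv hxv hvy with h' | h'
    · exact h'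
    · exact absurd hvy (arc_asymm (h y hy v h'))
  · rcases hQ.2 x (Or.inr hx) y (Or.inr hy) v hv hxv hvy with h' | h'
    · exact absurd hxv (arc_asymm (h v h' x hx))
    · exact h'

theorem splitters_cut {N : Set α} (hN : T.c3Structure.IsModule N) {s : α}
    (hs : s ∈ T.splitters N) (p : α → Prop)
    (h1 : ∀ t ∈ T.splitters N, p t → T.inside N t ⊆ T.inside N s)
    (h2 : ∀ t ∈ T.splitters N, ¬ p t → T.inside N s ⊆ T.inside N t)
    (h3 : ∀ t ∈ T.splitters N, ∀ t' ∈ T.splitters N, p t → ¬ p t' →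
      ¬ T.inside N t' ⊆ T.inside N t) :
    ∃ L R, L ∪ R = N ∪ T.splitters N ∧ (∀ a ∈ L, ∀ b ∈ R, T.arc a b) ∧
      (∀ x ∈ N, T.arc x s → x ∈ L) ∧ (∀ x ∈ N, T.arc s x → x ∈ R) ∧
      (∀ t ∈ T.splitters N, p t → t ∈ L) ∧ (∀ t ∈ T.splitters N, ¬ p t → t ∈ R) := by
  refine ⟨{x | (x ∈ N ∧ T.arc x s) ∨ (x ∈ T.splitters N ∧ p x)},
    {x | (x ∈ N ∧ T.arc s x) ∨ (x ∈ T.splitters N ∧ ¬ p x)}, ?_, ?_,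
    fun x hx h => Or.inl ⟨hx, h⟩, fun x hx h => Or.inl ⟨hx, h⟩,
    fun x hx h => Or.inr ⟨hx, h⟩, fun x hx h => Or.inr ⟨hx, h⟩⟩
  · ext x
    simp only [Set.mem_union, Set.mem_ofPred_eq]
    constructor
    · rintro ((h | h) | (h | h))
      · exact Or.inl h.1
      · exact Or.inr h.1
      · exact Or.inl h.1
      · exact Or.inr h.1
    · rintro (h | h)
      · rcases arc_or_arc (hN.1 h) hs.1 (fun e => hs.2.1 (e ▸ h)) with h' | h'
        · exact Or.inl (Or.inl ⟨h, h'⟩)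
        · exact Or.inr (Or.inl ⟨h, h'⟩)
      · by_cases hp : p x
        · exact Or.inl (Or.inr ⟨h, hp⟩)
        · exact Or.inr (Or.inr ⟨h, hp⟩)
  · rintro a (⟨ha, has⟩ | ⟨ha, hpa⟩) b (⟨hb, hsb⟩ | ⟨hb, hpb⟩)
    · exact arc_of_mem_splitters hN hs ha hb has hsb
    · exact (h2 b hb hpb ⟨ha, has⟩).2
    · rcases arc_or_arc ha.1 (hN.1 hb) (fun e => ha.2.1 (e ▸ hb)) with h | h
      · exact h
      · exact absurd hsb (arc_asymm (h1 a ha hpa ⟨hb, h⟩).2)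
    · rcases arc_or_arc ha.1 hb.1 (fun e => hpb (e ▸ hpa)) with h | h
      · exact h
      · exact absurd (inside_subset_of_arc hN h hb.2.1 ha.2.1 (Or.inl hb)) (h3 a ha b hb hpa hpb)

theorem inside_total {N : Set α} (hN : T.c3Structure.IsModule N) {s t : α}
    (hs : s ∈ T.splitters N) (ht : t ∈ T.splitters N) :
    T.inside N s ⊆ T.inside N t ∨ T.inside N t ⊆ T.inside N s := by
  by_cases hst : s = t
  · exact Or.inl (hst ▸ subset_rfl)
  · rcases arc_or_arc hs.1 ht.1 hst with h | h
    · exact Or.inl (inside_subset_of_arc hN h hs.2.1 ht.2.1 (Or.inl hs))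
    · exact Or.inr (inside_subset_of_arc hN h ht.2.1 hs.2.1 (Or.inl ht))

/-- The cut of `N ∪ T.splitters N` just before the splitter `s`. -/
theorem splitters_cut_before {N : Set α} (hN : T.c3Structure.IsModule N) {s : α}
    (hs : s ∈ T.splitters N) :
    ∃ L R, L ∪ R = N ∪ T.splitters N ∧ (∀ a ∈ L, ∀ b ∈ R, T.arc a b) ∧
      (∀ x ∈ N, T.arc x s → x ∈ L) ∧ (∀ x ∈ N, T.arc s x → x ∈ R) ∧ s ∈ R := by
  obtain ⟨L, R, e, h, hL, hR, -, h4⟩ :=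
    splitters_cut hN hs (fun t => ¬ T.inside N s ⊆ T.inside N t)
      (fun t ht hp => (inside_total hN hs ht).resolve_left hp)
      (fun t _ hp => not_not.1 hp)
      (fun t _ t' _ hp hp' h => hp ((not_not.1 hp').trans h))
  exact ⟨L, R, e, h, hL, hR, h4 s hs (not_not.2 subset_rfl)⟩

/-- The cut of `N ∪ T.splitters N` just after the splitter `s`. -/
theorem splitters_cut_after {N : Set α} (hN : T.c3Structure.IsModule N) {s : α}
    (hs : s ∈ T.splitters N) :
    ∃ L R, L ∪ R = N ∪ T.splitters N ∧ (∀ a ∈ L, ∀ b ∈ R, T.arc a b) ∧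
      (∀ x ∈ N, T.arc x s → x ∈ L) ∧ (∀ x ∈ N, T.arc s x → x ∈ R) ∧ s ∈ L := by
  obtain ⟨L, R, e, h, hL, hR, h4, -⟩ :=
    splitters_cut hN hs (fun t => T.inside N t ⊆ T.inside N s)
      (fun t _ hp => hp)
      (fun t ht hp => (inside_total hN hs ht).resolve_right hp)
      (fun t _ t' _ hp hp' h => hp' (h.trans hp))
  exact ⟨L, R, e, h, hL, hR, h4 s hs subset_rfl⟩

theorem union_subset_of_strong {L R M : Set α} (hQ : T.IsModule (L ∪ R))
    (h : ∀ a ∈ L, ∀ b ∈ R, T.arc a b) (hM : IsStrongMember T.modules M)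
    (hL : (M ∩ L).Nonempty) (hR : (M ∩ R).Nonempty) : L ∪ R ⊆ M := by
  obtain ⟨hL', hR'⟩ := hQ.of_cut h
  have hd : ∀ x ∈ L, x ∉ R := fun x hx hx' => T.irrefl x (h x hx x hx')
  obtain ⟨l, hlM, hl⟩ := hL
  obtain ⟨r, hrM, hr⟩ := hR
  refine Set.union_subset ?_ ?_
  · rcases hM.2 L hL' ⟨l, hlM, hl⟩ with h' | h'
    · exact absurd hr (hd r (h' hrM))
    · exact h'
  · rcases hM.2 R hR' ⟨r, hrM, hr⟩ with h' | h'
    · exact absurd (h' hlM) (hd l hl)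
    · exact h'

/-- A tournament and its `C₃`-structure have the same strong modules. -/
theorem isStrongMember_modules_c3Structure (T : Tournament α) (M : Set α) :
    IsStrongMember T.c3Structure.modules M ↔ IsStrongMember T.modules M := by
  constructor
  · intro hM
    refine ⟨?_, fun N hN h => hM.2 N (IsModule.c3Structure hN) h⟩
    refine isModule_of_splitters_eq_empty hM.1.1 (Set.eq_empty_of_forall_notMem fun s hs => ?_)
    obtain ⟨L, R, e, h, hL, hR, hsR⟩ := splitters_cut_before hM.1 hs
    have hRm : T.IsModule R := (IsModule.of_cut (e ▸ isModule_union_splitters hM.1) h).2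
    obtain ⟨x, hx, hxs⟩ := hs.2.2.1
    obtain ⟨y, hy, hsy⟩ := hs.2.2.2
    rcases hM.2 R hRm.c3Structure ⟨y, hy, hR y hy hsy⟩ with h' | h'
    · exact T.irrefl x (h x (hL x hx hxs) x (h' hx))
    · exact hs.2.1 (h' hsR)
  · intro hM
    refine ⟨IsModule.c3Structure hM.1, fun N hN hMN => ?_⟩
    by_contra hcon
    rw [not_or] at hcon
    obtain ⟨hMN', hNM⟩ := hcon
    have hQ : T.IsModule (N ∪ T.splitters N) := isModule_union_splitters hN
    obtain ⟨x, hxM, hxN⟩ := hMN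
    obtain ⟨s, hsM, hsN⟩ := Set.not_subset.1 hMN'
    rcases hM.2 _ hQ ⟨x, hxM, Or.inl hxN⟩ with h | h
    · have hs : s ∈ T.splitters N := (h hsM).resolve_left hsN
      rcases arc_or_arc (hN.1 hxN) hs.1 (fun e => hsN (e ▸ hxN)) with hxs | hsx
      · obtain ⟨L, R, e, hLR, hL, hR, hsR⟩ := splitters_cut_before hN hs
        have := union_subset_of_strong (e ▸ hQ) hLR hM ⟨x, hxM, hL x hxN hxs⟩ ⟨s, hsM, hsR⟩
        exact hNM fun n hn => this (e ▸ Or.inl hn)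
      · obtain ⟨L, R, e, hLR, hL, hR, hsL⟩ := splitters_cut_after hN hs
        have := union_subset_of_strong (e ▸ hQ) hLR hM ⟨s, hsM, hsL⟩ ⟨x, hxM, hR x hxN hsx⟩
        exact hNM fun n hn => this (e ▸ Or.inl hn)
    · exact hNM fun n hn => h (Or.inl hn)

theorem Pi_c3Structure (T : Tournament α) : T.c3Structure.Pi = T.Pi := by
  ext M
  simp only [Hypergraph.Pi, Tournament.Pi, mem_maxProperStrong,
    isStrongMember_modules_c3Structure]
  rfl

end Tournament

namespace Hypergraph

variable {α : Type*} {H : Hypergraph α}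

theorem isModule_vertexSet (H : Hypergraph α) : H.IsModule H.vertexSet :=
  ⟨subset_rfl, fun _ he _ hne => by
    obtain ⟨v, hv, hv'⟩ := hne
    exact absurd (H.subset_vertexSet_of_mem_edgeSet' he hv) hv'⟩

theorem isStrongMember_vertexSet (H : Hypergraph α) : IsStrongMember H.modules H.vertexSet :=
  ⟨H.isModule_vertexSet, fun _ hN _ => Or.inr hN.1⟩

theorem isModule_induce_iff {X Y : Set α} (hX : H.IsModule X) :
    (H.induce X hX.1).IsModule Y ↔ H.IsModule Y ∧ Y ⊆ X := by
  constructor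
  · intro hY
    have hYX : Y ⊆ X := hY.1
    refine ⟨⟨hYX.trans hX.1, fun e he hne hne' => ?_⟩, hYX⟩
    by_cases heX : e ⊆ X
    · obtain ⟨m, hm, h, h'⟩ := hY.2 e ⟨he, heX⟩ hne hne'
      exact ⟨m, hm, h, fun n hn => (h' n hn).1⟩
    · obtain ⟨y, hye, hy⟩ := hne
      obtain ⟨m, -, h, h'⟩ := hX.2 e he ⟨y, hye, hYX hy⟩ (Set.sdiff_nonempty.2 heX)
      have hym : y = m := by
        have : y ∈ ({m} : Set α) := h ▸ ⟨hye, hYX hy⟩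
        exact this
      subst hym
      refine ⟨y, hy, ?_, fun n hn => h' n (hYX hn)⟩
      ext v
      constructor
      · rintro ⟨hv, hvY⟩
        exact h ▸ ⟨hv, hYX hvY⟩
      · rintro rfl
        exact ⟨hye, hy⟩
  · rintro ⟨hY, hYX⟩
    refine ⟨hYX, fun e he hne hne' => ?_⟩
    obtain ⟨m, hm, h, h'⟩ := hY.2 e he.1 hne hne'
    refine ⟨m, hm, h, fun n hn => ⟨h' n hn, ?_⟩⟩
    rintro v (hv | rfl)
    · exact he.2 hv.1
    · exact hYX hn

theorem isStrongMember_induce_iff {X Y : Set α} (hX : IsStrongMember H.modules X) :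
    IsStrongMember (H.induce X hX.1.1).modules Y ↔ IsStrongMember H.modules Y ∧ Y ⊆ X := by
  have hX' : H.IsModule X := hX.1
  constructor
  · intro hY
    obtain ⟨hYm, hYX⟩ := (isModule_induce_iff hX').1 hY.1
    refine ⟨⟨hYm, fun N hN hne => ?_⟩, hYX⟩
    obtain ⟨y, hy, hyN⟩ := hne
    rcases hX.2 N hN ⟨y, hYX hy, hyN⟩ with h | h
    · exact Or.inl (hYX.trans h)
    · exact hY.2 N ((isModule_induce_iff hX').2 ⟨hN, h⟩) ⟨y, hy, hyN⟩
  · rintro ⟨hY, hYX⟩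
    exact ⟨(isModule_induce_iff hX').2 ⟨hY.1, hYX⟩,
      fun N hN hne => hY.2 N ((isModule_induce_iff hX').1 hN).1 hne⟩

/-- The partition `Π(H[X])`, for a strong module `X` with at least two elements. -/
def classes (H : Hypergraph α) (X : H.strongModulesGeTwo) : Set (Set α) :=
  (H.induce X (H.subset_vertexSet_of_strong X)).Pi

theorem mem_classes {X : H.strongModulesGeTwo} {A : Set α} :
    A ∈ H.classes X ↔ Maximal (fun Y => IsStrongMember H.modules Y ∧ Y ⊂ X) A := by
  have : (fun Y : Set α => IsStrongMember H.modules Y ∧ Y ⊂ X) =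
      fun Y => IsStrongMember (H.induce X (H.subset_vertexSet_of_strong X)).modules Y ∧
        Y ⊂ (X : Set α) := by
    funext Y
    rw [isStrongMember_induce_iff X.2.1]
    exact propext ⟨fun h => ⟨⟨h.1, h.2.subset⟩, h.2⟩, fun h => ⟨h.1.1, h.2⟩⟩
  rw [this]
  rfl

theorem isModularPartition_classes (X : H.strongModulesGeTwo) :
    (H.induce X (H.subset_vertexSet_of_strong X)).IsModularPartition (H.classes X) :=
  isModularPartition_Pi _ X.2.2

theorem eq_of_mem_classes {X : H.strongModulesGeTwo} {A B : Set α} {v : α}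
    (hA : A ∈ H.classes X) (hB : B ∈ H.classes X) (hvA : v ∈ A) (hvB : v ∈ B) : A = B := by
  have h := (isModularPartition_classes X).1
  exact (h.2 v ((h.1 A hA).2 hvA)).unique ⟨hA, hvA⟩ ⟨hB, hvB⟩

theorem exists_mem_classes {X : H.strongModulesGeTwo} {v : α} (hv : v ∈ (X : Set α)) :
    ∃ A ∈ H.classes X, v ∈ A :=
  ((isModularPartition_classes X).1.2 v hv).exists

theorem subset_of_mem_classes {X : H.strongModulesGeTwo} {A : Set α} (hA : A ∈ H.classes X) :
    A ⊆ X :=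
  ((isModularPartition_classes X).1.1 A hA).2

theorem isModule_of_mem_classes {X : H.strongModulesGeTwo} {A : Set α} (hA : A ∈ H.classes X) :
    H.IsModule A :=
  (mem_classes.1 hA).prop.1.1

/-- The least strong module including a given set of at least two vertices. -/
theorem exists_strong_separating (hfin : H.vertexSet.Finite) {e : Set α} (he : e ⊆ H.vertexSet)
    (hnt : e.Nontrivial) :
    ∃ X : H.strongModulesGeTwo, e ⊆ X ∧ ∀ A ∈ H.classes X, ¬ e ⊆ A := by
  have hf : {Y : Set α | IsStrongMember H.modules Y ∧ e ⊆ Y}.Finite :=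
    hfin.finite_subsets.subset fun Y hY => hY.1.1.1
  obtain ⟨X, -, hX⟩ := hf.exists_le_minimal
    (show H.vertexSet ∈ _ from ⟨H.isStrongMember_vertexSet, he⟩)
  have hXf : X.Finite := hfin.subset hX.prop.1.1.1
  have hcard : 2 ≤ X.ncard :=
    (Set.one_lt_ncard_iff_nontrivial_and_finite).2 ⟨hnt.mono hX.prop.2, hXf⟩
  refine ⟨⟨X, hX.prop.1, hcard⟩, hX.prop.2, fun A hA heA => ?_⟩
  have hA' := (mem_classes.1 hA).prop
  exact hA'.2.2 (hX.le_of_le ⟨hA'.1, heA⟩ hA'.2.1)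

/-- Two vertices are in distinct classes for at most one strong module. -/
theorem strong_separating_unique {X Y : H.strongModulesGeTwo} {x y : α} {A B A' B' : Set α}
    (hA : A ∈ H.classes X) (hB : B ∈ H.classes X) (hAB : A ≠ B)
    (hA' : A' ∈ H.classes Y) (hB' : B' ∈ H.classes Y) (hAB' : A' ≠ B')
    (hxA : x ∈ A) (hyB : y ∈ B) (hxA' : x ∈ A') (hyB' : y ∈ B') : X = Y := by
  have key : ∀ {X Y : H.strongModulesGeTwo} {A' B' : Set α},
      A' ∈ H.classes Y → B' ∈ H.classes Y → A' ≠ B' → x ∈ A' → y ∈ B' →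
      x ∈ (X : Set α) → y ∈ (X : Set α) → (X : Set α) ⊆ Y → X = Y := by
    intro X Y A' B' hA' hB' hAB' hxA' hyB' hxX hyX hXY
    by_contra hne
    have hss : (X : Set α) ⊂ Y := hXY.ssubset_of_ne fun h => hne (Subtype.ext h)
    have hXA : (X : Set α) ⊆ A' := by
      have hm := mem_classes.1 hA'
      rcases hm.prop.1.2 X X.2.1.1 ⟨x, hxA', hxX⟩ with h | h
      · exact hm.le_of_ge ⟨X.2.1, hss⟩ h
      · exact h
    exact hAB' (eq_of_mem_classes hA' hB' (hXA hyX) hyB')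
  have hxX := subset_of_mem_classes hA hxA
  have hyX := subset_of_mem_classes hB hyB
  have hxY := subset_of_mem_classes hA' hxA'
  have hyY := subset_of_mem_classes hB' hyB'
  rcases X.2.1.2 Y Y.2.1.1 ⟨x, hxX, hxY⟩ with h | h
  · exact key hA' hB' hAB' hxA' hyB' hxX hyX h
  · exact (key hA hB hAB hxA hyB hxY hyY h).symm

theorem exists_separating_classes (hfin : H.vertexSet.Finite) {x y : α} (hx : x ∈ H.vertexSet)
    (hy : y ∈ H.vertexSet) (hxy : x ≠ y) :
    ∃ X : H.strongModulesGeTwo, ∃ A ∈ H.classes X, ∃ B ∈ H.classes X,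
      A ≠ B ∧ x ∈ A ∧ y ∈ B := by
  obtain ⟨X, he, hX⟩ := exists_strong_separating hfin (e := {x, y})
    (by rintro v (rfl | rfl) <;> assumption) (Set.nontrivial_pair hxy)
  obtain ⟨A, hA, hxA⟩ := exists_mem_classes (he (Or.inl rfl))
  obtain ⟨B, hB, hyB⟩ := exists_mem_classes (he (Or.inr rfl))
  refine ⟨X, A, hA, B, hB, ?_, hxA, hyB⟩
  rintro rfl
  exact hX A hA (by rintro v (rfl | rfl) <;> assumption)

/-- An edge with two elements in a module is included in the module. -/
theorem IsModule.subset_of_mem_edgeSet {M e : Set α} (hM : H.IsModule M) (he : e ∈ H.edgeSet)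
    {x y : α} (hx : x ∈ e) (hy : y ∈ e) (hxy : x ≠ y) (hxM : x ∈ M) (hyM : y ∈ M) : e ⊆ M := by
  by_contra h
  obtain ⟨m, -, hm, -⟩ := hM.2 e he ⟨x, hx, hxM⟩ (Set.sdiff_nonempty.2 h)
  have h1 : x ∈ ({m} : Set α) := hm ▸ ⟨hx, hxM⟩
  have h2 : y ∈ ({m} : Set α) := hm ▸ ⟨hy, hyM⟩
  exact hxy (h1.trans h2.symm)

theorem IsModule.exchange {M : Set α} (hM : H.IsModule M) {x x' y z : α} (hx : x ∈ M)
    (hx' : x' ∈ M) (hy : y ∉ M) (hz : z ∉ M) (he : {x, y, z} ∈ H.edgeSet) :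
    {x', y, z} ∈ H.edgeSet := by
  obtain ⟨m, -, hm, h⟩ := hM.2 _ he ⟨x, Or.inl rfl, hx⟩ ⟨y, Or.inr (Or.inl rfl), hy⟩
  have hxm : x = m := by
    have : x ∈ ({m} : Set α) := hm ▸ ⟨Or.inl rfl, hx⟩
    exact this
  subst hxm
  have h := h x' hx'
  have hset : (({x, y, z} : Set α) \ {x}) ∪ {x'} = {x', y, z} := by
    ext u
    simp only [Set.mem_union, Set.mem_sdiff, Set.mem_insert_iff, Set.mem_singleton_iff]
    grind
  rwa [hset] at h

theorem IsModularPartition.disjoint {P : Set (Set α)} (hP : H.IsModularPartition P)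
    {A B : Set α} (hA : A ∈ P) (hB : B ∈ P) (hAB : A ≠ B) {v : α} (hv : v ∈ A) : v ∉ B :=
  fun hv' => hAB ((hP.1.2 v ((hP.1.1 A hA).2 hv)).unique ⟨hA, hv⟩ ⟨hB, hv'⟩)

theorem IsModularPartition.exchange {P : Set (Set α)} (hP : H.IsModularPartition P)
    {A B C : Set α} (hA : A ∈ P) (hB : B ∈ P) (hC : C ∈ P) (hAB : A ≠ B) (hBC : B ≠ C)
    (hAC : A ≠ C) {a b c a' b' c' : α} (ha : a ∈ A) (hb : b ∈ B) (hc : c ∈ C) (ha' : a' ∈ A)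
    (hb' : b' ∈ B) (hc' : c' ∈ C) (he : {a, b, c} ∈ H.edgeSet) : {a', b', c'} ∈ H.edgeSet := by
  have h1 := (hP.2 A hA).exchange ha ha' (hP.disjoint hB hA hAB.symm hb)
    (hP.disjoint hC hA hAC.symm hc) he
  rw [Set.insert_comm] at h1
  have h2 := (hP.2 B hB).exchange hb hb' (hP.disjoint hA hB hAB ha')
    (hP.disjoint hC hB hBC.symm hc) h1
  rw [Set.insert_comm, ← Set.insert_rotate] at h2
  have h3 := (hP.2 C hC).exchange hc hc' (hP.disjoint hA hC hAC ha')
    (hP.disjoint hB hC hBC hb') h2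
  rwa [Set.insert_rotate] at h3

theorem mem_edgeSet_quotient (hH : H.IsUniform 3) {P : Set (Set α)}
    (hP : H.IsModularPartition P) {E : Set (Set α)} :
    E ∈ (H.quotient P hP).edgeSet ↔ ∃ A ∈ P, ∃ B ∈ P, ∃ C ∈ P, A ≠ B ∧ B ≠ C ∧ A ≠ C ∧
      (∃ a ∈ A, ∃ b ∈ B, ∃ c ∈ C, {a, b, c} ∈ H.edgeSet) ∧ E = {A, B, C} := by
  have hcl : ∀ {A B : Set α} {v : α}, A ∈ P → B ∈ P → v ∈ A → v ∈ B → A = B :=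
    fun {A B v} hA hB hvA hvB => by
      by_contra h
      exact hP.disjoint hA hB h hvA hvB
  have htrace : ∀ {A B C : Set α} {a b c : α}, A ∈ P → B ∈ P → C ∈ P → a ∈ A → b ∈ B → c ∈ C →
      {X | X ∈ P ∧ (X ∩ {a, b, c}).Nonempty} = ({A, B, C} : Set (Set α)) := by
    intro A B C a b c hA hB hC ha hb hc
    ext X
    constructor
    · rintro ⟨hX, v, hv, (rfl | rfl | rfl)⟩
      · exact Or.inl (hcl hX hA hv ha)
      · exact Or.inr (Or.inl (hcl hX hB hv hb))
      · exact Or.inr (Or.inr (hcl hX hC hv hc))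
    · rintro (rfl | rfl | rfl)
      · exact ⟨hA, a, ha, Or.inl rfl⟩
      · exact ⟨hB, b, hb, Or.inr (Or.inl rfl)⟩
      · exact ⟨hC, c, hc, Or.inr (Or.inr rfl)⟩
  constructor
  · rintro ⟨-, hcard, e, he, rfl⟩
    have htwo : ∀ x ∈ e, ∀ y ∈ e, x ≠ y → ∀ D ∈ P, x ∈ D → y ∉ D := by
      intro x hx y hy hxy D hD hxD hyD
      have hsub := (hP.2 D hD).subset_of_mem_edgeSet he hx hy hxy hxD hyD
      have : {X | X ∈ P ∧ (X ∩ e).Nonempty} ⊆ ({D} : Set (Set α)) := by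
        rintro X ⟨hX, v, hv, hve⟩
        exact hcl hX hD hv (hsub hve)
      have := Set.ncard_le_ncard this (Set.finite_singleton D)
      rw [Set.ncard_singleton] at this
      omega
    obtain ⟨a, b, c, hab, hac, hbc, rfl⟩ := Set.ncard_eq_three.1 (hH e he)
    have hV := H.subset_vertexSet_of_mem_edgeSet' he
    have ia : a ∈ ({a, b, c} : Set α) := Or.inl rfl
    have ib : b ∈ ({a, b, c} : Set α) := Or.inr (Or.inl rfl)
    have ic : c ∈ ({a, b, c} : Set α) := Or.inr (Or.inr rfl)
    obtain ⟨A, hA, ha⟩ := (hP.1.2 a (hV ia)).exists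
    obtain ⟨B, hB, hb⟩ := (hP.1.2 b (hV ib)).exists
    obtain ⟨C, hC, hc⟩ := (hP.1.2 c (hV ic)).exists
    refine ⟨A, hA, B, hB, C, hC, ?_, ?_, ?_, ⟨a, ha, b, hb, c, hc, he⟩,
      htrace hA hB hC ha hb hc⟩
    · rintro rfl
      exact htwo a ia b ib hab A hA ha hb
    · rintro rfl
      exact htwo b ib c ic hbc B hB hb hc
    · rintro rfl
      exact htwo a ia c ic hac A hA ha hc
  · rintro ⟨A, hA, B, hB, C, hC, hAB, hBC, hAC, ⟨a, ha, b, hb, c, hc, he⟩, rfl⟩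
    refine ⟨?_, ?_, _, he, (htrace hA hB hC ha hb hc).symm⟩
    · rintro X (rfl | rfl | rfl) <;> assumption
    · rw [Set.ncard_eq_three.2 ⟨A, B, C, hAB, hAC, hBC, rfl⟩]
      omega

theorem insert_mem_edgeSet_quotient (hH : H.IsUniform 3) {P : Set (Set α)}
    (hP : H.IsModularPartition P) {A B C : Set α} (hA : A ∈ P) (hB : B ∈ P) (hC : C ∈ P)
    (hAB : A ≠ B) (hBC : B ≠ C) (hAC : A ≠ C) {a b c : α} (ha : a ∈ A) (hb : b ∈ B)
    (hc : c ∈ C) : {A, B, C} ∈ (H.quotient P hP).edgeSet ↔ {a, b, c} ∈ H.edgeSet := by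
  constructor
  · rintro ⟨-, hcard, e, he, h⟩
    have hmem : ∀ X, X ∈ ({A, B, C} : Set (Set α)) → ∃ v ∈ X, v ∈ e := fun X hX => by
      rw [h] at hX
      exact hX.2
    obtain ⟨a', ha', hae⟩ := hmem A (Or.inl rfl)
    obtain ⟨b', hb', hbe⟩ := hmem B (Or.inr (Or.inl rfl))
    obtain ⟨c', hc', hce⟩ := hmem C (Or.inr (Or.inr rfl))
    have n1 : a' ≠ b' := fun e => hP.disjoint hA hB hAB ha' (e ▸ hb')
    have n2 : b' ≠ c' := fun e => hP.disjoint hB hC hBC hb' (e ▸ hc')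
    have n3 : a' ≠ c' := fun e => hP.disjoint hA hC hAC ha' (e ▸ hc')
    have hsub : ({a', b', c'} : Set α) ⊆ e := by rintro v (rfl | rfl | rfl) <;> assumption
    have hfin : e.Finite := Set.finite_of_ncard_ne_zero (by rw [hH e he]; omega)
    have heq : ({a', b', c'} : Set α) = e := Set.eq_of_subset_of_ncard_le hsub
      (by rw [hH e he, Set.ncard_eq_three.2 ⟨a', b', c', n1, n3, n2, rfl⟩]) hfin
    exact hP.exchange hA hB hC hAB hBC hAC ha' hb' hc' ha hb hc (heq ▸ he)
  · intro he
    exact (mem_edgeSet_quotient hH hP).2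
      ⟨A, hA, B, hB, C, hC, hAB, hBC, hAC, ⟨a, ha, b, hb, c, hc, he⟩, rfl⟩

theorem IsUniform.induce {k : ℕ} (hH : H.IsUniform k) (W : Set α) (hW : W ⊆ H.vertexSet) :
    (H.induce W hW).IsUniform k :=
  fun e he => hH e he.1

end Hypergraph

namespace Tournament

variable {α : Type*} {T : Tournament α}

theorem IsCycle.pairwise_ne {x y z : α} (h : T.IsCycle x y z) : x ≠ y ∧ y ≠ z ∧ x ≠ z :=
  ⟨ne_of_arc h.1, ne_of_arc h.2.1, (ne_of_arc h.2.2).symm⟩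

theorem isUniform_c3Structure (T : Tournament α) : T.c3Structure.IsUniform 3 := by
  intro e he
  obtain ⟨x, y, z, h, rfl⟩ := mem_edgeSet_c3Structure.1 he
  obtain ⟨h1, h2, h3⟩ := h.pairwise_ne
  exact Set.ncard_eq_three.2 ⟨x, y, z, h1, h3, h2, rfl⟩

theorem c3Structure_induce (T : Tournament α) (W : Set α) (hW : W ⊆ T.vertexSet) :
    (T.induce W hW).c3Structure = T.c3Structure.induce W hW := by
  refine Hypergraph.ext rfl ?_
  ext e
  constructor
  · intro he
    obtain ⟨x, y, z, ⟨h1, h2, h3⟩, rfl⟩ := mem_edgeSet_c3Structure.1 he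
    refine ⟨mem_edgeSet_c3Structure.2 ⟨x, y, z, ⟨h1.2.2, h2.2.2, h3.2.2⟩, rfl⟩, ?_⟩
    rintro v (rfl | rfl | rfl)
    · exact h1.1
    · exact h2.1
    · exact h3.1
  · rintro ⟨he, heW⟩
    obtain ⟨x, y, z, ⟨h1, h2, h3⟩, rfl⟩ := mem_edgeSet_c3Structure.1 he
    have hx : x ∈ W := heW (Or.inl rfl)
    have hy : y ∈ W := heW (Or.inr (Or.inl rfl))
    have hz : z ∈ W := heW (Or.inr (Or.inr rfl))
    exact mem_edgeSet_c3Structure.2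
      ⟨x, y, z, ⟨⟨hx, hy, h1⟩, ⟨hy, hz, h2⟩, ⟨hz, hx, h3⟩⟩, rfl⟩

theorem quotient_arc_iff {P : Set (Set α)} (hP : T.IsModularPartition P) {A B : Set α}
    (hA : A ∈ P) (hB : B ∈ P) (hAB : A ≠ B) {a b : α} (ha : a ∈ A) (hb : b ∈ B) :
    (T.quotient P hP).arc A B ↔ T.arc a b := by
  have hd : ∀ {A B : Set α}, A ∈ P → B ∈ P → A ≠ B → ∀ v ∈ A, v ∉ B :=
    fun {A B} hA hB hAB v hv hv' => hAB ((hP.1.2 v ((hP.1.1 A hA).2 hv)).unique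
      ⟨hA, hv⟩ ⟨hB, hv'⟩)
  constructor
  · rintro ⟨-, -, -, x, hx, y, hy, h⟩
    exact (hP.2 B hB).arc_right hy hb (hd hA hB hAB a ha)
      ((hP.2 A hA).arc_left hx ha (hd hB hA hAB.symm y hy) h)
  · exact fun h => ⟨hA, hB, hAB, a, ha, b, hb, h⟩

theorem c3Structure_quotient {P P' : Set (Set α)} (h : P = P') (hP : T.IsModularPartition P)
    (hP' : T.c3Structure.IsModularPartition P') :
    T.c3Structure.quotient P' hP' = (T.quotient P hP).c3Structure := by
  subst h
  refine Hypergraph.ext rfl ?_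
  ext E
  rw [Hypergraph.mem_edgeSet_quotient T.isUniform_c3Structure hP']
  constructor
  · rintro ⟨A, hA, B, hB, C, hC, hAB, hBC, hAC, ⟨a, ha, b, hb, c, hc, he⟩, rfl⟩
    rw [insert_mem_edgeSet_c3Structure] at he ⊢
    unfold IsCycle at he ⊢
    rwa [quotient_arc_iff hP hA hB hAB ha hb, quotient_arc_iff hP hB hC hBC hb hc,
      quotient_arc_iff hP hC hA hAC.symm hc ha, quotient_arc_iff hP hA hC hAC ha hc,
      quotient_arc_iff hP hC hB hBC.symm hc hb, quotient_arc_iff hP hB hA hAB.symm hb ha]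
  · intro hE
    obtain ⟨A, B, C, h, rfl⟩ := mem_edgeSet_c3Structure.1 hE
    obtain ⟨hAB, hBC, hAC⟩ := h.pairwise_ne
    have hA := h.1.1
    have hB := h.1.2.1
    have hC := h.2.1.2.1
    obtain ⟨a, ha⟩ := (hP.1.1 A hA).1
    obtain ⟨b, hb⟩ := (hP.1.1 B hB).1
    obtain ⟨c, hc⟩ := (hP.1.1 C hC).1
    refine ⟨A, hA, B, hB, C, hC, hAB, hBC, hAC, ⟨a, ha, b, hb, c, hc, ?_⟩, rfl⟩
    exact mem_edgeSet_c3Structure.2 ⟨a, b, c, ⟨(quotient_arc_iff hP hA hB hAB ha hb).1 h.1,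
      (quotient_arc_iff hP hB hC hBC hb hc).1 h.2.1,
      (quotient_arc_iff hP hC hA hAC.symm hc ha).1 h.2.2⟩, rfl⟩

theorem c3Structure_quotientPi (h : 2 ≤ T.vertexSet.ncard) :
    T.c3Structure.quotientPi h = (T.quotientPi h).c3Structure :=
  c3Structure_quotient T.Pi_c3Structure.symm _ _

end Tournament

namespace Hypergraph

variable {α : Type*} {H : Hypergraph α}

theorem delta_mem_choices (T : H.realizations) : H.delta T ∈ H.choices := by
  intro X
  obtain ⟨T, hT⟩ := T
  obtain rfl : H = T.c3Structure := hT
  have key : ∀ (K K' : Hypergraph α) (h : 2 ≤ K.vertexSet.ncard) (h' : 2 ≤ K'.vertexSet.ncard),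
      K = K' → K.quotientPi h = K'.quotientPi h' := by
    rintro K _ h h' rfl
    rfl
  exact (key _ _ X.2.2 X.2.2 (T.c3Structure_induce X _).symm).trans
    (Tournament.c3Structure_quotientPi X.2.2)

theorem vertexSet_of_mem_choices {f : H.strongModulesGeTwo → Tournament (Set α)}
    (hf : f ∈ H.choices) (X : H.strongModulesGeTwo) : (f X).vertexSet = H.classes X :=
  (congrArg Hypergraph.vertexSet (hf X)).symm

theorem vertexSet_of_mem_realizations (T : H.realizations) : T.1.vertexSet = H.vertexSet :=
  (congrArg Hypergraph.vertexSet T.2).symm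

theorem delta_arc_iff (T : H.realizations) {X : H.strongModulesGeTwo} {A B : Set α}
    (hA : A ∈ H.classes X) (hB : B ∈ H.classes X) (hAB : A ≠ B) {a b : α} (ha : a ∈ A)
    (hb : b ∈ B) : (H.delta T X).arc A B ↔ T.1.arc a b := by
  have hv := vertexSet_of_mem_choices (delta_mem_choices T) X
  refine (Tournament.quotient_arc_iff (Tournament.isModularPartition_Pi _ X.2.2)
    (hv.symm ▸ hA : A ∈ (H.delta T X).vertexSet) (hv.symm ▸ hB : B ∈ (H.delta T X).vertexSet)
    hAB ha hb).trans ?_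
  exact ⟨fun h => h.2.2,
    fun h => ⟨subset_of_mem_classes hA ha, subset_of_mem_classes hB hb, h⟩⟩

theorem delta_injective (hfin : H.vertexSet.Finite) : Function.Injective H.delta := by
  intro T T' h
  have hV := vertexSet_of_mem_realizations T
  have hV' := vertexSet_of_mem_realizations T'
  refine Subtype.ext (Tournament.ext (hV.trans hV'.symm) ?_)
  funext x y
  by_cases hxy : x = y
  · subst hxy
    exact propext ⟨fun h => absurd h (T.1.irrefl x), fun h => absurd h (T'.1.irrefl x)⟩
  by_cases hx : x ∈ H.vertexSet
  · by_cases hy : y ∈ H.vertexSet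
    · obtain ⟨X, A, hA, B, hB, hAB, hxA, hyB⟩ := exists_separating_classes hfin hx hy hxy
      rw [← delta_arc_iff T hA hB hAB hxA hyB, ← delta_arc_iff T' hA hB hAB hxA hyB, h]
    · exact propext ⟨fun h => absurd (hV ▸ (T.1.arc_mem x y h).2) hy,
        fun h => absurd (hV' ▸ (T'.1.arc_mem x y h).2) hy⟩
  · exact propext ⟨fun h => absurd (hV ▸ (T.1.arc_mem x y h).1) hx,
      fun h => absurd (hV' ▸ (T'.1.arc_mem x y h).1) hx⟩

/-- The arcs prescribed by a choice of tournaments on the factors of `H`. -/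
def gluedArc (f : H.strongModulesGeTwo → Tournament (Set α)) (x y : α) : Prop :=
  ∃ X A B, x ∈ A ∧ y ∈ B ∧ (f X).arc A B

theorem gluedArc_iff {f : H.strongModulesGeTwo → Tournament (Set α)} (hf : f ∈ H.choices)
    {X : H.strongModulesGeTwo} {A B : Set α} (hA : A ∈ H.classes X) (hB : B ∈ H.classes X)
    (hAB : A ≠ B) {x y : α} (hx : x ∈ A) (hy : y ∈ B) :
    gluedArc f x y ↔ (f X).arc A B := by
  constructor
  · rintro ⟨Y, A', B', hx', hy', h⟩
    have hm := (f Y).arc_mem _ _ h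
    rw [vertexSet_of_mem_choices hf] at hm
    obtain rfl := strong_separating_unique hA hB hAB hm.1 hm.2 (Tournament.ne_of_arc h)
      hx hy hx' hy'
    rwa [eq_of_mem_classes hA hm.1 hx hx', eq_of_mem_classes hB hm.2 hy hy']
  · exact fun h => ⟨X, A, B, hx, hy, h⟩

/-- The tournament obtained by gluing together tournaments on the factors of `H`. -/
def glue (hfin : H.vertexSet.Finite) (f : H.choices) : Tournament α where
  vertexSet := H.vertexSet
  arc := gluedArc f.1
  finite_vertexSet := hfin
  arc_mem := by
    rintro x y ⟨X, A, B, hx, hy, h⟩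
    have hm := (f.1 X).arc_mem _ _ h
    rw [vertexSet_of_mem_choices f.2] at hm
    exact ⟨(isModule_of_mem_classes hm.1).1 hx, (isModule_of_mem_classes hm.2).1 hy⟩
  irrefl := by
    rintro x ⟨X, A, B, hx, hy, h⟩
    have hm := (f.1 X).arc_mem _ _ h
    rw [vertexSet_of_mem_choices f.2] at hm
    exact Tournament.ne_of_arc h (eq_of_mem_classes hm.1 hm.2 hx hy)
  arc_iff_not_arc := by
    intro x hx y hy hxy
    obtain ⟨X, A, hA, B, hB, hAB, hxA, hyB⟩ := exists_separating_classes hfin hx hy hxy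
    rw [gluedArc_iff f.2 hA hB hAB hxA hyB, gluedArc_iff f.2 hB hA hAB.symm hyB hxA]
    have hv := vertexSet_of_mem_choices f.2 X
    exact (f.1 X).arc_iff_not_arc A (hv ▸ hA) B (hv ▸ hB) hAB

theorem glue_arc_iff (hfin : H.vertexSet.Finite) (f : H.choices) {X : H.strongModulesGeTwo}
    {A B : Set α} (hA : A ∈ H.classes X) (hB : B ∈ H.classes X) (hAB : A ≠ B) {x y : α}
    (hx : x ∈ A) (hy : y ∈ B) : (glue hfin f).arc x y ↔ (f.1 X).arc A B :=
  gluedArc_iff f.2 hA hB hAB hx hy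

theorem insert_mem_edgeSet_iff_glue (hfin : H.vertexSet.Finite) (hH : H.IsUniform 3)
    (f : H.choices) {x y z : α} (hx : x ∈ H.vertexSet) (hy : y ∈ H.vertexSet)
    (hz : z ∈ H.vertexSet) (hxy : x ≠ y) (hyz : y ≠ z) (hxz : x ≠ z) :
    {x, y, z} ∈ H.edgeSet ↔ {x, y, z} ∈ (glue hfin f).c3Structure.edgeSet := by
  have hpair : ∀ {X : H.strongModulesGeTwo} {A C : Set α} {x y z : α}, A ∈ H.classes X →
      C ∈ H.classes X → A ≠ C → x ∈ A → y ∈ A → z ∈ C → x ≠ y →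
      ({x, y, z} ∈ H.edgeSet ↔ {x, y, z} ∈ (glue hfin f).c3Structure.edgeSet) := by
    intro X A C x y z hA hC hAC hx hy hz hxy
    have h1 := glue_arc_iff hfin f hA hC hAC hx hz
    have h2 := glue_arc_iff hfin f hA hC hAC hy hz
    have h3 := glue_arc_iff hfin f hC hA hAC.symm hz hx
    have h4 := glue_arc_iff hfin f hC hA hAC.symm hz hy
    have h5 : (f.1 X).arc A C → ¬ (f.1 X).arc C A := Tournament.arc_asymm
    refine iff_of_false (fun he => ?_) ?_
    · have := (isModule_of_mem_classes hA).subset_of_mem_edgeSet he (Or.inl rfl)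
        (Or.inr (Or.inl rfl)) hxy hx hy
      exact hAC (eq_of_mem_classes hA hC (this (Or.inr (Or.inr rfl))) hz)
    · rw [Tournament.insert_mem_edgeSet_c3Structure]
      unfold Tournament.IsCycle
      tauto
  obtain ⟨X, he, hX⟩ := exists_strong_separating hfin (e := {x, y, z})
    (by rintro v (rfl | rfl | rfl) <;> assumption)
    ⟨x, Or.inl rfl, y, Or.inr (Or.inl rfl), hxy⟩
  obtain ⟨A, hA, hxA⟩ := exists_mem_classes (he (Or.inl rfl))
  obtain ⟨B, hB, hyB⟩ := exists_mem_classes (he (Or.inr (Or.inl rfl)))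
  obtain ⟨C, hC, hzC⟩ := exists_mem_classes (he (Or.inr (Or.inr rfl)))
  have hnot : ¬ (A = B ∧ B = C) := by
    rintro ⟨rfl, rfl⟩
    exact hX A hA (by rintro v (rfl | rfl | rfl) <;> assumption)
  by_cases hAB : A = B
  · subst hAB
    exact hpair hA hC (fun h => hnot ⟨rfl, h⟩) hxA hyB hzC hxy
  by_cases hBC : B = C
  · subst hBC
    rw [Set.insert_rotate]
    exact hpair hB hA (Ne.symm hAB) hyB hzC hxA hyz
  by_cases hAC : A = C
  · subst hAC
    rw [Set.pair_comm y z]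
    exact hpair hA hB hAB hxA hzC hyB hxz
  have h1 := insert_mem_edgeSet_quotient (hH.induce X (H.subset_vertexSet_of_strong X))
    (isModularPartition_classes X) hA hB hC hAB hBC hAC hxA hyB hzC
  have h2 : {x, y, z} ∈ H.edgeSet ↔
      {x, y, z} ∈ (H.induce X (H.subset_vertexSet_of_strong X)).edgeSet :=
    ⟨fun h => ⟨h, he⟩, fun h => h.1⟩
  have h3 : {A, B, C} ∈ (H.factor X).edgeSet ↔ {A, B, C} ∈ (f.1 X).c3Structure.edgeSet := by
    rw [← show H.factor X = (f.1 X).c3Structure from f.2 X]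
  rw [h2, ← h1]
  refine h3.trans ?_
  rw [Tournament.insert_mem_edgeSet_c3Structure, Tournament.insert_mem_edgeSet_c3Structure]
  unfold Tournament.IsCycle
  rw [glue_arc_iff hfin f hA hB hAB hxA hyB, glue_arc_iff hfin f hB hC hBC hyB hzC,
    glue_arc_iff hfin f hC hA (Ne.symm hAC) hzC hxA, glue_arc_iff hfin f hA hC hAC hxA hzC,
    glue_arc_iff hfin f hC hB (Ne.symm hBC) hzC hyB,
    glue_arc_iff hfin f hB hA (Ne.symm hAB) hyB hxA]

theorem glue_realizes (hfin : H.vertexSet.Finite) (hH : H.IsUniform 3) (f : H.choices) :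
    (glue hfin f).Realizes H := by
  refine Hypergraph.ext rfl ?_
  have key : ∀ e : Set α, e ⊆ H.vertexSet → e.ncard = 3 →
      (e ∈ H.edgeSet ↔ e ∈ (glue hfin f).c3Structure.edgeSet) := by
    intro e he hc
    obtain ⟨x, y, z, hxy, hxz, hyz, rfl⟩ := Set.ncard_eq_three.1 hc
    exact insert_mem_edgeSet_iff_glue hfin hH f (he (Or.inl rfl)) (he (Or.inr (Or.inl rfl)))
      (he (Or.inr (Or.inr rfl))) hxy hyz hxz
  ext e
  constructor
  · intro h
    exact (key e (H.subset_vertexSet_of_mem_edgeSet' h) (hH e h)).1 h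
  · intro h
    exact (key e ((glue hfin f).c3Structure.subset_vertexSet_of_mem_edgeSet' h)
      ((glue hfin f).isUniform_c3Structure e h)).2 h

theorem delta_glue (hfin : H.vertexSet.Finite) (hH : H.IsUniform 3) (f : H.choices) :
    H.delta ⟨glue hfin f, glue_realizes hfin hH f⟩ = f.1 := by
  funext X
  have hv := vertexSet_of_mem_choices
    (delta_mem_choices ⟨glue hfin f, glue_realizes hfin hH f⟩) X
  have hv' := vertexSet_of_mem_choices f.2 X
  refine Tournament.ext (hv.trans hv'.symm) ?_
  funext A B
  have key : A ∈ H.classes X → B ∈ H.classes X → A ≠ B →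
      ((H.delta ⟨glue hfin f, glue_realizes hfin hH f⟩ X).arc A B ↔ (f.1 X).arc A B) := by
    intro hA hB hAB
    obtain ⟨a, ha⟩ := ((isModularPartition_classes X).1.1 A hA).1
    obtain ⟨b, hb⟩ := ((isModularPartition_classes X).1.1 B hB).1
    rw [delta_arc_iff _ hA hB hAB ha hb]
    exact glue_arc_iff hfin f hA hB hAB ha hb
  refine propext ⟨fun h => ?_, fun h => ?_⟩
  · have hm := Tournament.arc_mem _ _ _ h
    rw [hv] at hm
    exact (key hm.1 hm.2 (Tournament.ne_of_arc h)).1 h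
  · have hm := Tournament.arc_mem _ _ _ h
    rw [hv'] at hm
    exact (key hm.1 hm.2 (Tournament.ne_of_arc h)).2 h

end Hypergraph

theorem mainTheorem8 {α : Type*} (H : Hypergraph α) (hfin : H.vertexSet.Finite)
    (hH : H.IsUniform 3) :
    ∃ hδ : ∀ T : H.realizations, H.delta T ∈ H.choices,
      Function.Bijective (fun T : H.realizations => (⟨H.delta T, hδ T⟩ : H.choices)) := by
  refine ⟨Hypergraph.delta_mem_choices, fun T T' h => ?_, fun f => ?_⟩
  · exact Hypergraph.delta_injective hfin (congrArg Subtype.val h)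
  · exact ⟨⟨Hypergraph.glue hfin f, Hypergraph.glue_realizes hfin hH f⟩,
      Subtype.ext (Hypergraph.delta_glue hfin hH f)⟩
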